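/- Let $k$ be a field of characteristic zero, $\Gamma$ an abelian group and $\epsilon:\Gamma\times\Gamma\to k^{\ast}$ a commutation factor, i.e. $\epsilon(\alpha,\beta)\epsilon(\beta,\alpha)=1$, $\epsilon(\alpha,\beta+\gamma)=\epsilon(\alpha,\beta)\epsilon(\alpha,\gamma)$ and $\epsilon(\alpha+\beta,\gamma)=\epsilon(\alpha,\gamma)\epsilon(\beta,\gamma)$. Let $S=\bigoplus_{\gamma\in\Gamma}S_\gamma$ be a finite-dimensional generalized left-symmetric algebra: a $\Gamma$-graded nonassociative $k$-algebra with $S_\alpha\cdot S_\beta\subseteq S_{\alpha+\beta}$ and $$(x\cdot y)\cdot z-x\cdot(y\cdot z)=\epsilon(\alpha,\beta)\big((y\cdot x)\cdot z-y\cdot(x\cdot z)\big)\qquad(x\in S_\alpha,\ y\in S_\beta,\ z\in S).$$ Let $M=\bigoplus_{\gamma\in\Gamma}M_\gamma$ be a finite-dimensional $S$-bimodule: a graded space with bilinear left and right actions of $S$ satisfying $S_\alpha\cdot M_\gamma\subseteq M_{\alpha+\gamma}$, $M_\gamma\cdot S_\alpha\subseteq M_{\gamma+\alpha}$ and, for $x\in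 S_\alpha$, $y\in S_\beta$, $m\in M_\gamma$, $$(x\cdot y)\cdot m-x\cdot(y\cdot m)=\epsilon(\alpha,\beta)\big((y\cdot x)\cdot m-y\cdot(x\cdot m)\big),$$ $$(x\cdot m)\cdot y-x\cdot(m\cdot y)=\epsilon(\alpha,\gamma)\big((m\cdot x)\cdot y-m\cdot(x\cdot y)\big).$$ Put $[x,y]=x\cdot y-\epsilon(\alpha,\beta)\,y\cdot x$ for $x\in S_\alpha$, $y\in S_\beta$. Let $\wedge^n_\epsilon S$ be the quotient of $S^{\otimes n}$ by the degree-$n$ part of the two-sided ideal of the tensor algebra generated by all $x\otimes y+\epsilon(\alpha,\beta)\,y\otimes x$ with $x\in S_\alpha$, $y\in S_\beta$. For $i\ge1$ let $T^i=\mathrm{Hom}(S^{\otimes (i-1)}\otimes S,M)$ and $C^i(S,M)=\mathrm{Hom}(\wedge^{i-1}_\epsilon S\otimes S,M)$, which is regarded as a subspace of $T^i$, and let $C^0(S,M)=\{m\in M\mid (ab)m=a(bm)\text{ for all }a,b\in S\}$. A map $f\in T^i$ is homogeneous of degree $\beta$ if $f(x_1,\dots,x_i)\in M_{\beta+\alpha_1+\cdots+\alpha_i}$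 whenever $x_s\in S_{\alpha_s}$. For $t\ge1$ let $D_t:T^i\to T^{i+1}$ be the linear map with $D_t=0$ for $t>i$ and, for $t\le i$, $f$ homogeneous of degree $\beta$ and $x_s\in S_{\alpha_s}$, $$\begin{aligned}(D_tf)(x_1,\dots,x_{i+1})={}&\epsilon(\beta+\alpha_1+\cdots+\alpha_{t-1},\alpha_t)\,x_t\cdot f(x_1,\dots,\hat x_t,\dots,x_{i+1})\\&-\epsilon(\alpha_t,\alpha_{t+1}+\cdots+\alpha_i)\,f(x_1,\dots,\hat x_t,\dots,x_i,x_t\cdot x_{i+1})\\&+\epsilon(\alpha_t,\alpha_{t+1}+\cdots+\alpha_i)\,f(x_1,\dots,\hat x_t,\dots,x_i,x_t)\cdot x_{i+1}\\&-\sum_{t<j\le i}\epsilon(\alpha_t,\alpha_{t+1}+\cdots+\alpha_{j-1})\,f(x_1,\dots,\hat x_t,\dots,x_{j-1},[x_t,x_j],\dots,x_i,x_{i+1}).\end{aligned}$$ Then the following hold. (1) The operators $D_t$ are well defined and homogeneous of degree zero, and $D_tD_s=D_sD_{t-1}$ on $T^i$, in particular on $C^i(S,M)$, for all $1\le s<t$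 and $i\ge1$. (2) The operator $d=-\sum_t(-1)^tD_t$ satisfies $d^2=0$ on $\bigoplus_{i\ge1}T^i$. (3) The operator $d$ maps $C^i(S,M)$ to $C^{i+1}(S,M)$ for $i\ge1$. There is a unique linear map $d:C^0(S,M)\to C^1(S,M)$ with $(dm)(x)=\epsilon(\beta,\alpha)\,x\cdot m-m\cdot x$ for $m\in C^0(S,M)\cap M_\beta$ and $x\in S_\alpha$. With these maps, which are homogeneous of degree zero, $C^0(S,M)\to C^1(S,M)\to C^2(S,M)\to\cdots$ is a cochain complex, i.e. $d^2=0$. So the coboundaries $B^i(S,M)$ lie in the cocycles $Z^i(S,M)$, and the cohomology spaces $H^i(S,M)=Z^i(S,M)/B^i(S,M)$ are defined. -/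

import Mathlib

open scoped TensorProduct DirectSum

universe uΓ uk uS uM

/-- A commutation factor on the abelian group `Γ` with values in the units of the field `k`. -/
structure CommutationFactor (Γ : Type uΓ) (k : Type uk) [AddCommGroup Γ] [Field k] where
  val : Γ → Γ → kˣ
  val_mul_val_swap : ∀ α β, val α β * val β α = 1
  val_add_right : ∀ α β γ, val α (β + γ) = val α β * val α γ
  val_add_left : ∀ α β γ, val (α + β) γ = val α γ * val β γ

instance {Γ : Type uΓ} {k : Type uk} [AddCommGroup Γ] [Field k] :
    CoeFun (CommutationFactor Γ k) (fun _ => Γ → Γ → kˣ) := ⟨CommutationFactor.val⟩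

noncomputable section

section

variable {Γ : Type uΓ} {k : Type uk} [AddCommGroup Γ] [DecidableEq Γ] [Field k]
variable {S : Type uS} [AddCommGroup S] [Module k S]
variable {M : Type uM} [AddCommGroup M] [Module k M]

/-- A generalized left-symmetric algebra structure on the graded space `S = ⨁ γ, 𝒮 γ`. -/
structure GenLeftSymmAlgebra (ε : CommutationFactor Γ k) (𝒮 : Γ → Submodule k S)
    [DirectSum.Decomposition 𝒮] where
  mul : S →ₗ[k] S →ₗ[k] S
  mul_mem : ∀ {α β : Γ} {x y : S}, x ∈ 𝒮 α → y ∈ 𝒮 β → mul x y ∈ 𝒮 (α + β)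
  left_symm : ∀ {α β : Γ} {x y : S} (z : S), x ∈ 𝒮 α → y ∈ 𝒮 β →
    mul (mul x y) z - mul x (mul y z) = ε α β • (mul (mul y x) z - mul y (mul x z))

variable {ε : CommutationFactor Γ k}
variable {𝒮 : Γ → Submodule k S} [DirectSum.Decomposition 𝒮]
variable {ℳ : Γ → Submodule k M} [DirectSum.Decomposition ℳ]

/-- `A.bracket α β x y = x·y - ε(α, β) y·x`: on `x ∈ S_α`, `y ∈ S_β` this is the
`ε`-commutator `[x, y]`. -/
def GenLeftSymmAlgebra.bracket (A : GenLeftSymmAlgebra ε 𝒮) (α β : Γ) : S →ₗ[k] S →ₗ[k] S :=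
  A.mul - ε α β • A.mul.flip

/-- A bimodule structure on the graded space `M = ⨁ γ, ℳ γ` over a generalized left-symmetric
algebra; both actions are compatible with the gradations. -/
structure GenLeftSymmBimodule (A : GenLeftSymmAlgebra ε 𝒮) (ℳ : Γ → Submodule k M)
    [DirectSum.Decomposition ℳ] where
  left : S →ₗ[k] M →ₗ[k] M
  right : M →ₗ[k] S →ₗ[k] M
  left_mem : ∀ {α γ : Γ} {x : S} {m : M}, x ∈ 𝒮 α → m ∈ ℳ γ → left x m ∈ ℳ (α + γ)
  right_mem : ∀ {α γ : Γ} {x : S} {m : M}, m ∈ ℳ γ → x ∈ 𝒮 α → right m x ∈ ℳ (γ + α)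
  left_left : ∀ {α β : Γ} {x y : S} (m : M), x ∈ 𝒮 α → y ∈ 𝒮 β →
    left (A.mul x y) m - left x (left y m) = ε α β • (left (A.mul y x) m - left y (left x m))
  left_right : ∀ {α γ : Γ} {x : S} {m : M} (y : S), x ∈ 𝒮 α → m ∈ ℳ γ →
    right (left x m) y - left x (right m y) = ε α γ • (right (right m x) y - right m (A.mul x y))

/-! ### Tensor cochains -/

variable (k S M) in
/-- `TensorCochain k S M n` is `Hom(S^{⊗ n} ⊗ S, M)`: the maps `f(x₁, …, xₙ; y)` that are
linear in each of the `n + 1` arguments. -/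
abbrev TensorCochain (n : ℕ) : Type (max uS uM) :=
  MultilinearMap k (fun _ : Fin n => S) (S →ₗ[k] M)

variable (𝒮 ℳ) in
/-- The tensor cochains that are homogeneous of degree `β`. -/
def homogeneousTensorCochain (n : ℕ) (β : Γ) : Submodule k (TensorCochain k S M n) where
  carrier := {f | ∀ (α : Fin n → Γ) (δ : Γ) (v : Fin n → S) (y : S),
    (∀ s, v s ∈ 𝒮 (α s)) → y ∈ 𝒮 δ → f v y ∈ ℳ (β + ∑ s, α s + δ)}
  add_mem' hf hg α δ v y hv hy := (ℳ _).add_mem (hf α δ v y hv hy) (hg α δ v y hv hy)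
  zero_mem' _ _ _ _ _ _ := (ℳ _).zero_mem
  smul_mem' c _ hf α δ v y hv hy := (ℳ _).smul_mem c (hf α δ v y hv hy)

/-- The linear map that is multiplication by `ε(μ, α)` on the component of degree `μ`. -/
def degreeScale {V : Type*} [AddCommGroup V] [Module k V] (ε : CommutationFactor Γ k)
    (𝒱 : Γ → Submodule k V) [DirectSum.Decomposition 𝒱] (α : Γ) : V →ₗ[k] V :=
  (DirectSum.toModule k Γ V fun μ => ε μ α • (𝒱 μ).subtype) ∘ₗ
    (DirectSum.decomposeLinearEquiv 𝒱).toLinearMap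

variable (ε 𝒮 ℳ) in
/-- The linear map on tensor cochains that is multiplication by `ε(β, α)` on those of degree `β`:
`f` goes to `degreeScale α ∘ f ∘ (degreeScale (-α))^{⊗}`. -/
def cochainScale (n : ℕ) (α : Γ) : TensorCochain k S M n →ₗ[k] TensorCochain k S M n where
  toFun f :=
    ((degreeScale ε ℳ α).compRight k ∘ₗ
      (LinearMap.lcomp k M (degreeScale ε 𝒮 (-α)))).compMultilinearMap
        (f.compLinearMap fun _ => degreeScale ε 𝒮 (-α))
  map_add' _ _ := by ext; simp
  map_smul' _ _ := by ext; simp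

variable (𝒮) in
/-- The multilinear map that agrees with `F α` on homogeneous arguments of degrees
`α₁, …, αₙ`. -/
def extendHomogeneous {N : Type*} [AddCommGroup N] [Module k N] {n : ℕ} :
    ((Fin n → Γ) → MultilinearMap k (fun _ : Fin n => S) N) →ₗ[k]
      MultilinearMap k (fun _ : Fin n => S) N where
  toFun F :=
    (MultilinearMap.fromDirectSumEquiv (R := k) (κ := fun _ : Fin n => Γ)
      (M := fun _ γ => 𝒮 γ)
      (fun α => (F α).compLinearMap fun s => (𝒮 (α s)).subtype)).compLinearMap
        fun _ => (DirectSum.decomposeLinearEquiv 𝒮).toLinearMap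
  map_add' F G := by
    ext v
    have h : (fun α => ((F + G) α).compLinearMap fun s => (𝒮 (α s)).subtype) =
        (fun α => (F α).compLinearMap fun s => (𝒮 (α s)).subtype) +
          (fun α => (G α).compLinearMap fun s => (𝒮 (α s)).subtype) := rfl
    rw [h, map_add]; rfl
  map_smul' c F := by
    ext v
    have h : (fun α => ((c • F) α).compLinearMap fun s => (𝒮 (α s)).subtype) =
        c • (fun α => (F α).compLinearMap fun s => (𝒮 (α s)).subtype) := rfl
    rw [h, map_smul]; rfl

/-- `(v₁, …, vₙ₊₁) ↦ B(v_t, f(v₁, …, v̂_t, …, vₙ₊₁))`. -/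
def insertTerm {N : Type*} [AddCommGroup N] [Module k N] {n : ℕ} (t : Fin (n + 1))
    (B : S →ₗ[k] N →ₗ[k] N) :
    MultilinearMap k (fun _ : Fin n => S) N →ₗ[k]
      MultilinearMap k (fun _ : Fin (n + 1) => S) N where
  toFun f := MultilinearMap.mk' (fun v => B (v t) (f (t.removeNth v)))
    (by
      intro v i x y
      induction i using Fin.succAboveCases t with
      | x => simp
      | p i => simp [Fin.removeNth_update_succAbove])
    (by
      intro v i c x
      induction i using Fin.succAboveCases t with
      | x => simp
      | p i => simp [Fin.removeNth_update_succAbove])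
  map_add' _ _ := by ext; simp
  map_smul' _ _ := by ext; simp

/-- `(v₁, …, vₙ₊₁) ↦ f(v₁, …, v̂_t, …, b(v_t, v_j), …, vₙ₊₁)` with `b(v_t, v_j)` in place of
`v_j`, for `t < j`. -/
def bracketTerm {N : Type*} [AddCommGroup N] [Module k N] {n : ℕ} (b : S →ₗ[k] S →ₗ[k] S)
    (t : Fin (n + 1)) (j : {j : Fin (n + 1) // t < j}) :
    MultilinearMap k (fun _ : Fin n => S) N →ₗ[k]
      MultilinearMap k (fun _ : Fin (n + 1) => S) N where
  toFun f := MultilinearMap.mk'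
    (fun v => f (t.removeNth (Function.update v j.1 (b (v t) (v j.1)))))
    (by
      obtain ⟨j, hj⟩ := j
      obtain ⟨j, rfl⟩ := Fin.exists_succAbove_eq hj.ne'
      intro v i x y
      induction i using Fin.succAboveCases t with
      | x => simp [Fin.removeNth_update_succAbove]
      | p i =>
        rcases eq_or_ne i j with rfl | h
        · simp [Fin.removeNth_update_succAbove]
        · simp [Fin.removeNth_update_succAbove, Function.update_comm h, h.symm])
    (by
      obtain ⟨j, hj⟩ := j
      obtain ⟨j, rfl⟩ := Fin.exists_succAbove_eq hj.ne'
      intro v i c x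
      induction i using Fin.succAboveCases t with
      | x => simp [Fin.removeNth_update_succAbove]
      | p i =>
        rcases eq_or_ne i j with rfl | h
        · simp [Fin.removeNth_update_succAbove]
        · simp [Fin.removeNth_update_succAbove, Function.update_comm h, h.symm])
  map_add' _ _ := by ext; simp
  map_smul' _ _ := by ext; simp

namespace GenLeftSymmBimodule

variable {A : GenLeftSymmAlgebra ε 𝒮} (B : GenLeftSymmBimodule A ℳ)

/-- `(x, g) ↦ (y ↦ x · g(y))`. -/
def actValue : S →ₗ[k] (S →ₗ[k] M) →ₗ[k] (S →ₗ[k] M) :=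
  LinearMap.mk₂ k (fun x g => B.left x ∘ₗ g)
    (by intros; ext; simp) (by intros; ext; simp) (by intros; ext; simp) (by intros; ext; simp)

/-- `(x, g) ↦ (y ↦ g(x · y))`. -/
def actLast (_ : GenLeftSymmBimodule A ℳ) : S →ₗ[k] (S →ₗ[k] M) →ₗ[k] (S →ₗ[k] M) :=
  LinearMap.mk₂ k (fun x g => g ∘ₗ A.mul x)
    (by intros; ext; simp) (by intros; ext; simp) (by intros; ext; simp) (by intros; ext; simp)

/-- `(x, g) ↦ (y ↦ g(x) · y)`. -/
def actRight : S →ₗ[k] (S →ₗ[k] M) →ₗ[k] (S →ₗ[k] M) :=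
  LinearMap.mk₂ k (fun x g => B.right (g x))
    (by intros; ext; simp) (by intros; ext; simp) (by intros; ext; simp) (by intros; ext; simp)

/-- The operator `D_{t+1}` (positions are counted from `0` here). On arguments
`x₁, …, xₙ₊₁; y` with `x_s` of degree `α_s` and on `f` of degree `β` its first term is
`ε(β + α₁ + ⋯ + α_{t-1}, α_t) x_t · f(…, x̂_t, …; y)`; the factor `ε(β, α_t)` is produced by
`cochainScale`. -/
def face (n : ℕ) (t : Fin (n + 1)) : TensorCochain k S M n →ₗ[k] TensorCochain k S M (n + 1) :=
  extendHomogeneous 𝒮 ∘ₗ LinearMap.pi fun α : Fin (n + 1) → Γ =>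
    ε (∑ s ∈ Finset.Iio t, α s) (α t) • (insertTerm t B.actValue ∘ₗ cochainScale ε 𝒮 ℳ n (α t))
    - ε (α t) (∑ s ∈ Finset.Ioi t, α s) • insertTerm t B.actLast
    + ε (α t) (∑ s ∈ Finset.Ioi t, α s) • insertTerm t B.actRight
    - ∑ j : {j : Fin (n + 1) // t < j},
        ε (α t) (∑ s ∈ Finset.Ioo t j.1, α s) • bracketTerm (A.bracket (α t) (α j.1)) t j

/-- The operators `D_t`, `t = 1, 2, 3, …`, on `Hom(S^{⊗ n} ⊗ S, M)`, with `D_t = 0` for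
`t > n + 1`. -/
def D (t n : ℕ) : TensorCochain k S M n →ₗ[k] TensorCochain k S M (n + 1) :=
  if h : 1 ≤ t ∧ t ≤ n + 1 then B.face n ⟨t - 1, by omega⟩ else 0

/-- `d = - ∑_t (-1)^t D_t` on `Hom(S^{⊗ n} ⊗ S, M)`. -/
def tensorDiff (n : ℕ) : TensorCochain k S M n →ₗ[k] TensorCochain k S M (n + 1) :=
  -∑ t ∈ Finset.Icc 1 (n + 1), (-1 : k) ^ t • B.D t n

end GenLeftSymmBimodule

/-! ### The cochain spaces `C^i(S, M)` -/

variable (ε 𝒮) in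
/-- The degree-`n` part of the two-sided ideal of the tensor algebra of `S` generated by the
`x ⊗ y + ε(a, b) y ⊗ x` with `x ∈ S_a`, `y ∈ S_b`. -/
def extRelations (n : ℕ) : Submodule k (⨂[k] _ : Fin n, S) :=
  Submodule.span k {z | ∃ (p q : Fin n) (v : Fin n → S) (a b : Γ),
    (p : ℕ) + 1 = q ∧ v p ∈ 𝒮 a ∧ v q ∈ 𝒮 b ∧
    z = PiTensorProduct.tprod k v + ε a b • PiTensorProduct.tprod k (v ∘ Equiv.swap p q)}

variable (ε 𝒮) in
/-- The `n`-th `ε`-exterior power of `S`. -/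
abbrev ExtPower (n : ℕ) : Type (max uS uk) := (⨂[k] _ : Fin n, S) ⧸ extRelations ε 𝒮 n

variable (ε 𝒮) in
/-- The product `x₁ ∧ ⋯ ∧ xₙ` as a multilinear map. -/
def wedge (n : ℕ) : MultilinearMap k (fun _ : Fin n => S) (ExtPower ε 𝒮 n) :=
  (extRelations ε 𝒮 n).mkQ.compMultilinearMap (PiTensorProduct.tprod k)

variable (ε 𝒮 M) in
/-- `Cochain M ε 𝒮 n` is `C^{n+1}(S, M) = Hom(⋀^n S ⊗ S, M)`. -/
abbrev Cochain (n : ℕ) : Type (max uS uk uM) := (ExtPower ε 𝒮 n ⊗[k] S) →ₗ[k] M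

/-- The inclusion `Hom(⋀^n S ⊗ S, M) → Hom(S^{⊗ n} ⊗ S, M)`,
`f(x₁, …, xₙ; y) = f((x₁ ∧ ⋯ ∧ xₙ) ⊗ y)`. -/
def Cochain.toTensor {n : ℕ} : Cochain M ε 𝒮 n →ₗ[k] TensorCochain k S M n where
  toFun f := (TensorProduct.curry f).compMultilinearMap (wedge ε 𝒮 n)
  map_add' _ _ := by ext; simp
  map_smul' _ _ := by ext; simp

variable (ε 𝒮 ℳ) in
/-- The cochains in `C^{n+1}(S, M)` that are homogeneous of degree `β`. -/
def homogeneousCochain (n : ℕ) (β : Γ) : Submodule k (Cochain M ε 𝒮 n) :=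
  (homogeneousTensorCochain 𝒮 ℳ n β).comap Cochain.toTensor

namespace GenLeftSymmBimodule

variable {A : GenLeftSymmAlgebra ε 𝒮} (B : GenLeftSymmBimodule A ℳ)

/-- `C^0(S, M) = {m ∈ M | (ab)m = a(bm) for all a, b ∈ S}`. -/
def cochainZero : Submodule k M where
  carrier := {m | ∀ a b : S, B.left (A.mul a b) m = B.left a (B.left b m)}
  add_mem' hx hy a b := by simp only [map_add, hx a b, hy a b]
  zero_mem' a b := by simp
  smul_mem' c x hx a b := by simp only [map_smul, hx a b]

/-- `d₀ : C^0(S, M) → C^1(S, M)` satisfies `(d₀ m)(x) = ε(β, α) x·m - m·x` for `x ∈ S_α` and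
`m ∈ C^0(S, M) ∩ M_β`. -/
def IsCoboundaryZero (d₀ : B.cochainZero →ₗ[k] Cochain M ε 𝒮 0) : Prop :=
  ∀ (α β : Γ) (m : B.cochainZero) (x : S), (m : M) ∈ ℳ β → x ∈ 𝒮 α →
    (d₀ m).toTensor Fin.elim0 x = ε β α • B.left x m - B.right m x

/-- `d : C^{n+1}(S, M) → C^{n+2}(S, M)`, `n ≥ 0`, is the restriction of `-∑_t (-1)^t D_t`. -/
def IsCoboundarySucc (d : ∀ n, Cochain M ε 𝒮 n →ₗ[k] Cochain M ε 𝒮 (n + 1)) : Prop :=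
  ∀ (n : ℕ) (f : Cochain M ε 𝒮 n), (d n f).toTensor = B.tensorDiff n f.toTensor

end GenLeftSymmBimodule

end

end

/-!
For homogeneous `x` let `ι_x` be the contraction with the first argument and put `L_x = ι_x D₁`.
For `t ≥ 1` the operator `D_{t+1}` leaves the first argument alone, so `ι_x D_{t+1} = D_t ι_x`. If
`x ∈ S_a` and `y ∈ S_b`, then `ι_y L_x = ε(a, b) L_x ι_y - ι_{[x, y]}`, and induction on the number
of arguments, with the bimodule identities as base case and the `ε`-Jacobi identity in the inductive
step, gives `L_y L_x = ε(a, b) L_x L_y - L_{[x, y]}`. In other words `L_x` commutes with `D₁`, and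
hence with every `D_t`. Contracting `D_t D_s = D_s D_{t-1}` with `x` leads to the same identity with
`s` and `t` lowered by one if `s > 1`, and to `D_{t-1} L_x = L_x D_{t-1}` if `s = 1`. Cartan's
formula `ι_x d + d ι_x = L_x` then gives `d² = 0` and, since `L_x` preserves the `ε`-alternating
cochains, that so does `d`.
-/

noncomputable section

namespace CommutationFactor

variable {Γ : Type uΓ} {k : Type uk} [AddCommGroup Γ] [Field k] (ε : CommutationFactor Γ k)

theorem val_zero_right (α : Γ) : ε α 0 = 1 := by
  simpa using ε.val_add_right α 0 0

theorem val_zero_left (α : Γ) : ε 0 α = 1 := by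
  simpa using ε.val_add_left 0 0 α

theorem val_neg_right (α β : Γ) : ε α (-β) = ε β α := by
  have h : ε α β * ε α (-β) = 1 := by
    rw [← ε.val_add_right, add_neg_cancel, val_zero_right]
  exact mul_left_cancel (h.trans (ε.val_mul_val_swap α β).symm)

theorem coe_mul_coe_swap (α β : Γ) : (ε α β : k) * ε β α = 1 := by
  rw [← Units.val_mul, ε.val_mul_val_swap, Units.val_one]

end CommutationFactor

theorem sum_Ioo_zero_succ {N : Type*} [AddCommMonoid N] {n : ℕ} (f : Fin (n + 1) → N)
    (t : Fin n) : ∑ s ∈ Finset.Ioo 0 t.succ, f s = ∑ s ∈ Finset.Iio t, f s.succ := by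
  rw [← Fin.map_succEmb_Iio, Finset.sum_map]
  rfl

theorem sum_Iio_succ {N : Type*} [AddCommMonoid N] {n : ℕ} (f : Fin (n + 1) → N) (t : Fin n) :
    ∑ s ∈ Finset.Iio t.succ, f s = f 0 + ∑ s ∈ Finset.Iio t, f s.succ := by
  rw [← Finset.Ico_bot, bot_eq_zero, ← Finset.add_sum_Ioo_eq_sum_Ico t.succ_pos, sum_Ioo_zero_succ]

theorem sum_Iio_zero {N : Type*} [AddCommMonoid N] {n : ℕ} (f : Fin (n + 1) → N) :
    ∑ s ∈ Finset.Iio 0, f s = 0 := rfl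

theorem cons_mem {ι V σ : Type*} [SetLike σ V] {𝒱 : ι → σ} {n : ℕ} {i : ι} {x : V}
    {α : Fin n → ι} {v : Fin n → V} (hx : x ∈ 𝒱 i) (hv : ∀ s, v s ∈ 𝒱 (α s)) (s : Fin (n + 1)) :
    (Fin.cons x v : Fin (n + 1) → V) s ∈ 𝒱 ((Fin.cons i α : Fin (n + 1) → ι) s) :=
  Fin.cases hx hv s

section HomogeneousExt

variable {ι R V N : Type*} [DecidableEq ι] [CommSemiring R] [AddCommMonoid V] [Module R V]
  [AddCommMonoid N] [Module R N]

theorem linearMap_ext_of_homogeneous (𝒱 : ι → Submodule R V) [DirectSum.Decomposition 𝒱]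
    {f g : V →ₗ[R] N} (h : ∀ (i : ι) (x : V), x ∈ 𝒱 i → f x = g x) : f = g :=
  DirectSum.decompose_lhom_ext 𝒱 fun i => LinearMap.ext fun x => h i x x.2

variable (R) in
/-- Evaluation at the first argument, as a bilinear map: `evalHead R x f` is the contraction `ι_x f`
of the multilinear map `f` with `x`. -/
def evalHead {n : ℕ} : V →ₗ[R] MultilinearMap R (fun _ : Fin (n + 1) => V) N →ₗ[R]
    MultilinearMap R (fun _ : Fin n => V) N :=
  (multilinearCurryLeftEquiv R (fun _ => V) N).toLinearMap.flip

theorem evalHead_apply {n : ℕ} (x : V) (f : MultilinearMap R (fun _ : Fin (n + 1) => V) N)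
    (v : Fin n → V) : evalHead R x f v = f (Fin.cons x v) := rfl

theorem ext_evalHead {n : ℕ} {f g : MultilinearMap R (fun _ : Fin (n + 1) => V) N}
    (h : ∀ x : V, evalHead R x f = evalHead R x g) : f = g :=
  (multilinearCurryLeftEquiv R (fun _ => V) N).injective (LinearMap.ext h)

theorem ext_evalHead_of_homogeneous (𝒱 : ι → Submodule R V) [DirectSum.Decomposition 𝒱] {n : ℕ}
    {f g : MultilinearMap R (fun _ : Fin (n + 1) => V) N}
    (h : ∀ (i : ι) (x : V), x ∈ 𝒱 i → evalHead R x f = evalHead R x g) : f = g :=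
  (multilinearCurryLeftEquiv R (fun _ => V) N).injective (linearMap_ext_of_homogeneous 𝒱 h)

theorem multilinearMap_ext_of_homogeneous (𝒱 : ι → Submodule R V) [DirectSum.Decomposition 𝒱]
    {n : ℕ} {f g : MultilinearMap R (fun _ : Fin n => V) N}
    (h : ∀ (α : Fin n → ι) (v : Fin n → V), (∀ s, v s ∈ 𝒱 (α s)) → f v = g v) : f = g := by
  induction n with
  | zero => ext v; exact h Fin.elim0 v (fun s => s.elim0)
  | succ n ih =>
    exact ext_evalHead_of_homogeneous 𝒱 fun i x hx => ih fun α v hv =>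
      h (Fin.cons i α) (Fin.cons x v) (cons_mem hx hv)

end HomogeneousExt

section Graded

variable {ι R V W N : Type*} [DecidableEq ι] [CommSemiring R] [AddCommMonoid V] [Module R V]
  [AddCommMonoid W] [Module R W] [AddCommMonoid N] [Module R N]
  (𝒱 : ι → Submodule R V) [DirectSum.Decomposition 𝒱]

theorem linearMap_ext_of_isHomogeneous {p : Submodule R V}
    (hp : DirectSum.SetLike.IsHomogeneous 𝒱 p) {f g : p →ₗ[R] N}
    (h : ∀ (i : ι) (x : p), (x : V) ∈ 𝒱 i → f x = g x) : f = g := by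
  classical
  ext x
  have hx : x = ∑ i ∈ (DirectSum.decompose 𝒱 (x : V)).support,
      (⟨DirectSum.decompose 𝒱 (x : V) i, hp i x.2⟩ : p) := by
    ext
    rw [Submodule.coe_sum]
    exact (DirectSum.sum_support_decompose 𝒱 (x : V)).symm
  rw [hx, map_sum, map_sum]
  exact Finset.sum_congr rfl fun i _ => h i _ (DirectSum.decompose 𝒱 (x : V) i).2

theorem coe_decompose_apply_of_homogeneous [Add ι] [IsLeftCancelAdd ι] (𝒲 : ι → Submodule R W)
    [DirectSum.Decomposition 𝒲] {f : V →ₗ[R] W} {d : ι}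
    (hf : ∀ (i : ι) (x : V), x ∈ 𝒱 i → f x ∈ 𝒲 (d + i)) (i : ι) (x : V) :
    (DirectSum.decompose 𝒲 (f x) (d + i) : W) = f (DirectSum.decompose 𝒱 x i) := by
  induction x using DirectSum.Decomposition.inductionOn 𝒱 with
  | zero => simp
  | add x y hx hy => simp [DirectSum.decompose_add, hx, hy]
  | @homogeneous j x =>
    have hfx := hf j x x.2
    rcases eq_or_ne j i with rfl | h
    · rw [DirectSum.decompose_of_mem_same _ hfx, DirectSum.decompose_of_mem_same _ x.2]
    · rw [DirectSum.decompose_of_mem_ne _ hfx (by simpa using h),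
        DirectSum.decompose_of_mem_ne _ x.2 h, map_zero]

end Graded

theorem extendHomogeneous_apply {Γ k S N : Type*} [DecidableEq Γ] [Field k] [AddCommGroup S]
    [Module k S] [AddCommGroup N] [Module k N] {𝒮 : Γ → Submodule k S} [DirectSum.Decomposition 𝒮]
    {n : ℕ} (F : (Fin n → Γ) → MultilinearMap k (fun _ : Fin n => S) N) {α : Fin n → Γ}
    {v : Fin n → S} (hv : ∀ s, v s ∈ 𝒮 (α s)) : extendHomogeneous 𝒮 F v = F α v := by
  have h : (fun s => DirectSum.decompose 𝒮 (v s)) =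
      fun s => DirectSum.lof k Γ (fun γ => 𝒮 γ) (α s) ⟨v s, hv s⟩ :=
    funext fun s => DirectSum.decompose_of_mem 𝒮 (hv s)
  change MultilinearMap.fromDirectSumEquiv _ (fun s => DirectSum.decompose 𝒮 (v s)) = _
  rw [h, MultilinearMap.fromDirectSumEquiv_lof]
  rfl

section HomogeneousTensorCochain

variable {Γ k S M : Type*} [AddCommGroup Γ] [Field k] [AddCommGroup S] [Module k S]
  [AddCommGroup M] [Module k M] {𝒮 : Γ → Submodule k S} {ℳ : Γ → Submodule k M} {β : Γ}

theorem mem_homogeneousTensorCochain_zero {f : TensorCochain k S M 0} :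
    f ∈ homogeneousTensorCochain 𝒮 ℳ 0 β ↔
      ∀ (δ : Γ) (v : Fin 0 → S) (y : S), y ∈ 𝒮 δ → f v y ∈ ℳ (β + δ) := by
  refine ⟨fun h δ v y hy => ?_, fun h α δ v y _ hy => ?_⟩
  · simpa using h Fin.elim0 δ v y (fun s => s.elim0) hy
  · simpa using h δ v y hy

theorem mem_homogeneousTensorCochain_succ {n : ℕ} {f : TensorCochain k S M (n + 1)} :
    f ∈ homogeneousTensorCochain 𝒮 ℳ (n + 1) β ↔
      ∀ (a : Γ) (x : S), x ∈ 𝒮 a → evalHead k x f ∈ homogeneousTensorCochain 𝒮 ℳ n (β + a) := by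
  refine ⟨fun h a x hx α δ v y hv hy => ?_, fun h α δ v y hv hy => ?_⟩
  · simpa only [evalHead_apply, Fin.sum_cons, ← add_assoc] using
      h (Fin.cons a α) δ (Fin.cons x v) y (cons_mem hx hv) hy
  · have hmem := h (α 0) (v 0) (hv 0) (Fin.tail α) δ (Fin.tail v) y (fun s => hv s.succ) hy
    rw [evalHead_apply, Fin.cons_self_tail] at hmem
    rwa [Fin.sum_univ_succ, ← add_assoc]

end HomogeneousTensorCochain

theorem cons_comp_swap_succ {V : Type*} {n : ℕ} (x : V) (v : Fin n → V) (p q : Fin n) :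
    (Fin.cons x v : Fin (n + 1) → V) ∘ Equiv.swap p.succ q.succ =
      (Fin.cons x (v ∘ Equiv.swap p q) : Fin (n + 1) → V) := by
  rw [Equiv.comp_swap_eq_update, Equiv.comp_swap_eq_update, Fin.cons_update, Fin.cons_update,
    Fin.cons_succ, Fin.cons_succ]

theorem cons_cons_comp_swap {V : Type*} {n : ℕ} (x y : V) (v : Fin n → V) :
    (Fin.cons x (Fin.cons y v : Fin (n + 1) → V) : Fin (n + 2) → V) ∘ Equiv.swap 0 1 =
      (Fin.cons y (Fin.cons x v : Fin (n + 1) → V) : Fin (n + 2) → V) := by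
  rw [Equiv.comp_swap_eq_update, ← Fin.succ_zero_eq_one, ← Fin.cons_update, Fin.update_cons_zero,
    Fin.update_cons_zero, Fin.cons_zero, Fin.cons_succ, Fin.cons_zero]

section AltTensorCochain

variable {Γ k S M : Type*} [AddCommGroup Γ] [Field k] [AddCommGroup S] [Module k S]
  [AddCommGroup M] [Module k M] {ε : CommutationFactor Γ k} {𝒮 : Γ → Submodule k S}

variable (ε 𝒮 M) in
/-- The `ε`-alternating tensor cochains: those with `f(…, x, y, …) = -ε(a, b) f(…, y, x, …)` for
`x ∈ S_a` and `y ∈ S_b`. They turn out to be the image of `C^{n+1}(S, M)`. -/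
def altTensorCochain (n : ℕ) : Submodule k (TensorCochain k S M n) where
  carrier := {f | ∀ (p q : Fin n) (v : Fin n → S) (a b : Γ), (p : ℕ) + 1 = q → v p ∈ 𝒮 a →
    v q ∈ 𝒮 b → f v + ε a b • f (v ∘ Equiv.swap p q) = 0}
  add_mem' {f g} hf hg p q v a b h hp hq := by
    rw [add_apply, add_apply, smul_add, add_add_add_comm,
      hf p q v a b h hp hq, hg p q v a b h hp hq, add_zero]
  zero_mem' _ _ _ _ _ _ _ _ := by simp
  smul_mem' c f hf p q v a b h hp hq := by
    rw [smul_apply, smul_apply, smul_comm, ← smul_add, hf p q v a b h hp hq, smul_zero]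

theorem mem_altTensorCochain_of_le_one {n : ℕ} (hn : n ≤ 1) (f : TensorCochain k S M n) :
    f ∈ altTensorCochain M ε 𝒮 n := by
  intro p q _ _ _ h
  omega

theorem evalHead_mem_altTensorCochain {n : ℕ} {f : TensorCochain k S M (n + 1)}
    (hf : f ∈ altTensorCochain M ε 𝒮 (n + 1)) (x : S) :
    evalHead k x f ∈ altTensorCochain M ε 𝒮 n := by
  intro p q v a b h hp hq
  have hswap := hf p.succ q.succ (Fin.cons x v) a b (by simp [h]) hp hq
  rwa [cons_comp_swap_succ] at hswap

theorem evalHead_evalHead_add_swap {n : ℕ} {f : TensorCochain k S M (n + 2)}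
    (hf : f ∈ altTensorCochain M ε 𝒮 (n + 2)) {a b : Γ} {x y : S} (hx : x ∈ 𝒮 a) (hy : y ∈ 𝒮 b) :
    evalHead k y (evalHead k x f) + ε a b • evalHead k x (evalHead k y f) = 0 := by
  ext1 v
  have hswap := hf 0 1 (Fin.cons x (Fin.cons y v : Fin (n + 1) → S)) a b rfl hx hy
  rwa [cons_cons_comp_swap] at hswap

theorem mem_altTensorCochain_add_two [DecidableEq Γ] [DirectSum.Decomposition 𝒮] {n : ℕ}
    {f : TensorCochain k S M (n + 2)}
    (hhead : ∀ (a : Γ) (x : S), x ∈ 𝒮 a → evalHead k x f ∈ altTensorCochain M ε 𝒮 (n + 1))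
    (hswap : ∀ (a b : Γ) (x y : S), x ∈ 𝒮 a → y ∈ 𝒮 b →
      evalHead k y (evalHead k x f) + ε a b • evalHead k x (evalHead k y f) = 0) :
    f ∈ altTensorCochain M ε 𝒮 (n + 2) := by
  have hhead' : (altTensorCochain M ε 𝒮 (n + 1)).mkQ ∘ₗ (evalHead k).flip f = 0 :=
    linearMap_ext_of_homogeneous 𝒮 fun a x hx =>
      (Submodule.Quotient.mk_eq_zero _).2 (hhead a x hx)
  intro p q v a b h hp hq
  cases v using Fin.consCases with | _ x v => ?_
  obtain ⟨q, rfl⟩ := Fin.exists_succ_eq.2 (show q ≠ 0 by rintro rfl; simp at h)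
  cases p using Fin.cases with
  | succ p =>
    rw [cons_comp_swap_succ]
    exact (Submodule.Quotient.mk_eq_zero _).1 (LinearMap.congr_fun hhead' x) p q v a b
      (by simpa using h) hp hq
  | zero =>
    obtain rfl : q = 0 := by ext; simpa using h.symm
    cases v using Fin.consCases with | _ y v => ?_
    rw [Fin.succ_zero_eq_one, cons_cons_comp_swap]
    exact congrArg (fun g => g v) (hswap a b x y hp hq)

end AltTensorCochain

section Cochain

variable {Γ k S M : Type*} [AddCommGroup Γ] [Field k] [AddCommGroup S] [Module k S]
  [AddCommGroup M] [Module k M] {ε : CommutationFactor Γ k} {𝒮 : Γ → Submodule k S}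

theorem Cochain.toTensor_apply {n : ℕ} (f : Cochain M ε 𝒮 n) (v : Fin n → S) (y : S) :
    f.toTensor v y = f (wedge ε 𝒮 n v ⊗ₜ y) := rfl

theorem Cochain.toTensor_injective {n : ℕ} :
    Function.Injective (Cochain.toTensor : Cochain M ε 𝒮 n →ₗ[k] TensorCochain k S M n) :=
  fun _ _ h => TensorProduct.curry_injective <| Submodule.linearMap_qext _ <|
    PiTensorProduct.ext h

theorem wedge_add_swap {n : ℕ} {p q : Fin n} (hpq : (p : ℕ) + 1 = q) {v : Fin n → S} {a b : Γ}
    (hp : v p ∈ 𝒮 a) (hq : v q ∈ 𝒮 b) :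
    wedge ε 𝒮 n v + ε a b • wedge ε 𝒮 n (v ∘ Equiv.swap p q) = 0 :=
  (Submodule.Quotient.mk_eq_zero _).2 (Submodule.subset_span ⟨p, q, v, a, b, hpq, hp, hq, rfl⟩)

theorem Cochain.toTensor_mem {n : ℕ} (f : Cochain M ε 𝒮 n) :
    f.toTensor ∈ altTensorCochain M ε 𝒮 n := by
  intro p q v a b h hp hq
  have hwedge := congrArg (TensorProduct.curry f) (wedge_add_swap (ε := ε) h hp hq)
  rwa [Units.smul_def, map_add, map_smul, map_zero] at hwedge

theorem extRelations_le_ker_lift {n : ℕ} {f : TensorCochain k S M n}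
    (hf : f ∈ altTensorCochain M ε 𝒮 n) :
    extRelations ε 𝒮 n ≤ LinearMap.ker (PiTensorProduct.lift f) := by
  refine Submodule.span_le.2 ?_
  rintro z ⟨p, q, v, a, b, h, hp, hq, rfl⟩
  simpa [Units.smul_def] using hf p q v a b h hp hq

theorem Cochain.range_toTensor (n : ℕ) :
    LinearMap.range (Cochain.toTensor : Cochain M ε 𝒮 n →ₗ[k] TensorCochain k S M n) =
      altTensorCochain M ε 𝒮 n := by
  refine le_antisymm (LinearMap.range_le_iff_comap.2 (Submodule.eq_top_iff'.2 toTensor_mem))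
    fun f hf => ?_
  refine ⟨TensorProduct.lift ((extRelations ε 𝒮 n).liftQ _ (extRelations_le_ker_lift hf)), ?_⟩
  ext v y
  simp [toTensor_apply, wedge]

variable (ε 𝒮 M) in
/-- `C^{n+1}(S, M) = Hom(⋀^n S ⊗ S, M)` as the space of `ε`-alternating tensor cochains. -/
def cochainEquiv (n : ℕ) : Cochain M ε 𝒮 n ≃ₗ[k] altTensorCochain M ε 𝒮 n :=
  (LinearEquiv.ofInjective _ Cochain.toTensor_injective).trans
    (LinearEquiv.ofEq _ _ (Cochain.range_toTensor n))

theorem toTensor_cochainEquiv_symm {n : ℕ} (f : altTensorCochain M ε 𝒮 n) :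
    ((cochainEquiv M ε 𝒮 n).symm f).toTensor = f :=
  congrArg Subtype.val ((cochainEquiv M ε 𝒮 n).apply_symm_apply f)

end Cochain

section

variable {Γ : Type uΓ} {k : Type uk} [AddCommGroup Γ] [DecidableEq Γ] [Field k]
  {S : Type uS} [AddCommGroup S] [Module k S] {M : Type uM} [AddCommGroup M] [Module k M]
  {ε : CommutationFactor Γ k} {𝒮 : Γ → Submodule k S} [DirectSum.Decomposition 𝒮]
  {ℳ : Γ → Submodule k M} [DirectSum.Decomposition ℳ]

/-! ### The commutator algebra and the twisted left action -/

theorem degreeScale_of_mem {V : Type*} [AddCommGroup V] [Module k V] {𝒱 : Γ → Submodule k V}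
    [DirectSum.Decomposition 𝒱] (α : Γ) {μ : Γ} {x : V} (hx : x ∈ 𝒱 μ) :
    degreeScale ε 𝒱 α x = ε μ α • x := by
  simp [degreeScale, DirectSum.decomposeLinearEquiv, DirectSum.decompose_of_mem 𝒱 hx,
    ← DirectSum.lof_eq_of k]

theorem cochainScale_apply {n : ℕ} (a : Γ) (f : TensorCochain k S M n) (v : Fin n → S) (y : S) :
    cochainScale ε 𝒮 ℳ n a f v y = degreeScale ε ℳ a
      (f (fun s => degreeScale ε 𝒮 (-a) (v s)) (degreeScale ε 𝒮 (-a) y)) := rfl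

theorem evalHead_cochainScale {n : ℕ} (a : Γ) (f : TensorCochain k S M (n + 1)) {b : Γ} {x : S}
    (hx : x ∈ 𝒮 b) :
    evalHead k x (cochainScale ε 𝒮 ℳ (n + 1) a f) =
      ε a b • cochainScale ε 𝒮 ℳ n a (evalHead k x f) := by
  have hcons (v : Fin n → S) :
      (fun s => degreeScale ε 𝒮 (-a) ((Fin.cons x v : Fin (n + 1) → S) s)) =
        Fin.cons ((ε a b : k) • x) (fun s => degreeScale ε 𝒮 (-a) (v s)) := by
    funext s
    cases s using Fin.cases <;>
      simp [degreeScale_of_mem (-a) hx, ε.val_neg_right, Units.smul_def]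
  ext v y
  rw [evalHead_apply, cochainScale_apply, hcons, ← evalHead_apply]
  simp [cochainScale_apply, Units.smul_def]

namespace GenLeftSymmAlgebra

variable (A : GenLeftSymmAlgebra ε 𝒮)

theorem bracket_apply (a b : Γ) (x y : S) :
    A.bracket a b x y = A.mul x y - ε a b • A.mul y x := rfl

theorem bracket_mem {a b : Γ} {x y : S} (hx : x ∈ 𝒮 a) (hy : y ∈ 𝒮 b) :
    A.bracket a b x y ∈ 𝒮 (a + b) :=
  (𝒮 _).sub_mem (A.mul_mem hx hy)
    ((𝒮 _).smul_mem (ε a b : k) (add_comm b a ▸ A.mul_mem hy hx))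

theorem smul_bracket_swap (a b : Γ) (x y : S) :
    ε a b • A.bracket b a y x = -A.bracket a b x y := by
  simp [bracket_apply, smul_sub, smul_smul, ε.val_mul_val_swap]

theorem mul_bracket {a b : Γ} {x y : S} (hx : x ∈ 𝒮 a) (hy : y ∈ 𝒮 b) (z : S) :
    A.mul (A.bracket a b x y) z = A.mul x (A.mul y z) - ε a b • A.mul y (A.mul x z) := by
  have h := A.left_symm z hx hy
  simp only [bracket_apply, map_sub, LinearMap.sub_apply, map_smul, LinearMap.smul_apply,
    Units.smul_def] at h ⊢
  linear_combination (norm := module) h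

theorem jacobi {a b c : Γ} {x y z : S} (hx : x ∈ 𝒮 a) (hy : y ∈ 𝒮 b) (hz : z ∈ 𝒮 c) :
    A.bracket a (b + c) x (A.bracket b c y z) =
      A.bracket (a + b) c (A.bracket a b x y) z +
        ε a b • A.bracket b (a + c) y (A.bracket a c x z) := by
  rw [bracket_apply A a (b + c), bracket_apply A (a + b) c, bracket_apply A b (a + c),
    A.mul_bracket hx hy, A.mul_bracket hx hz, A.mul_bracket hy hz]
  simp only [bracket_apply, map_sub, map_smul, Units.smul_def, ε.val_add_left, ε.val_add_right,
    Units.val_mul]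
  linear_combination (norm := module)
    ε.coe_mul_coe_swap a b • ((ε b c : k) • A.mul x (A.mul z y) -
      (ε b c * ε a c : k) • A.mul z (A.mul x y))

end GenLeftSymmAlgebra

namespace GenLeftSymmBimodule

variable {A : GenLeftSymmAlgebra ε 𝒮} (B : GenLeftSymmBimodule A ℳ)

theorem left_bracket {a b : Γ} {x y : S} (hx : x ∈ 𝒮 a) (hy : y ∈ 𝒮 b) (m : M) :
    B.left (A.bracket a b x y) m = B.left x (B.left y m) - ε a b • B.left y (B.left x m) := by
  have h := B.left_left m hx hy
  simp only [A.bracket_apply, map_sub, LinearMap.sub_apply, map_smul, LinearMap.smul_apply,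
    Units.smul_def] at h ⊢
  linear_combination (norm := module) h

/-- The left action with its sign rule: `twistedLeft x m = ε(γ, α) x · m` for `x ∈ S_α` and
`m ∈ M_γ`. -/
def twistedLeft : S →ₗ[k] M →ₗ[k] M :=
  (DirectSum.toModule k Γ (M →ₗ[k] M) fun α =>
    LinearMap.lcomp k M (degreeScale ε ℳ α) ∘ₗ B.left ∘ₗ (𝒮 α).subtype) ∘ₗ
      (DirectSum.decomposeLinearEquiv 𝒮).toLinearMap

theorem twistedLeft_apply {a : Γ} {x : S} (hx : x ∈ 𝒮 a) (m : M) :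
    B.twistedLeft x m = B.left x (degreeScale ε ℳ a m) := by
  simp [twistedLeft, DirectSum.decomposeLinearEquiv, DirectSum.decompose_of_mem 𝒮 hx,
    ← DirectSum.lof_eq_of k]

theorem twistedLeft_of_mem {a γ : Γ} {x : S} {m : M} (hx : x ∈ 𝒮 a) (hm : m ∈ ℳ γ) :
    B.twistedLeft x m = ε γ a • B.left x m := by
  rw [B.twistedLeft_apply hx, degreeScale_of_mem a hm, Units.smul_def, map_smul, Units.smul_def]

theorem twistedLeft_mem {a γ : Γ} {x : S} {m : M} (hx : x ∈ 𝒮 a) (hm : m ∈ ℳ γ) :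
    B.twistedLeft x m ∈ ℳ (γ + a) := by
  rw [B.twistedLeft_of_mem hx hm, add_comm]
  exact (ℳ _).smul_mem (ε γ a : k) (B.left_mem hx hm)

theorem twistedLeft_twistedLeft {a b : Γ} {x y : S} (hx : x ∈ 𝒮 a) (hy : y ∈ 𝒮 b) (m : M) :
    B.twistedLeft y (B.twistedLeft x m) =
      ε a b • B.twistedLeft x (B.twistedLeft y m) - B.twistedLeft (A.bracket a b x y) m := by
  suffices h : B.twistedLeft y ∘ₗ B.twistedLeft x =
      ε a b • B.twistedLeft x ∘ₗ B.twistedLeft y - B.twistedLeft (A.bracket a b x y) from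
    LinearMap.congr_fun h m
  refine linearMap_ext_of_homogeneous ℳ fun γ m hm => ?_
  rw [LinearMap.comp_apply, LinearMap.sub_apply, LinearMap.smul_apply, LinearMap.comp_apply,
    B.twistedLeft_of_mem hy (B.twistedLeft_mem hx hm), B.twistedLeft_of_mem hx hm,
    B.twistedLeft_of_mem hx (B.twistedLeft_mem hy hm), B.twistedLeft_of_mem hy hm,
    B.twistedLeft_of_mem (A.bracket_mem hx hy) hm, B.left_bracket hx hy]
  simp only [Units.smul_def, map_smul, ε.val_add_left, ε.val_add_right, Units.val_mul]
  linear_combination (norm := module)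
    -ε.coe_mul_coe_swap a b • ((ε γ a * ε γ b : k) • B.left x (B.left y m))

theorem right_twistedLeft {a b : Γ} {x y : S} (hx : x ∈ 𝒮 a) (hy : y ∈ 𝒮 b) (m : M) :
    B.right (B.twistedLeft x m) y - ε a b • B.twistedLeft x (B.right m y) =
      B.right (B.right m x) y - B.right m (A.mul x y) := by
  suffices h : B.right.flip y ∘ₗ B.twistedLeft x - ε a b • B.twistedLeft x ∘ₗ B.right.flip y =
      B.right.flip y ∘ₗ B.right.flip x - B.right.flip (A.mul x y) from
    LinearMap.congr_fun h m
  refine linearMap_ext_of_homogeneous ℳ fun γ m hm => ?_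
  have h := B.left_right y hx hm
  simp only [LinearMap.comp_apply, LinearMap.sub_apply, LinearMap.smul_apply, LinearMap.flip_apply,
    B.twistedLeft_of_mem hx hm, B.twistedLeft_of_mem hx (B.right_mem hm hy), Units.smul_def,
    map_smul, ε.val_add_left, Units.val_mul] at h ⊢
  linear_combination (norm := module) (ε γ a : k) • h -
    ε.coe_mul_coe_swap a b • ((ε γ a : k) • B.left x (B.right m y)) +
    ε.coe_mul_coe_swap γ a • (B.right (B.right m x) y - B.right m (A.mul x y))

theorem face_apply {n : ℕ} (t : Fin (n + 1)) (f : TensorCochain k S M n) {α : Fin (n + 1) → Γ}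
    {v : Fin (n + 1) → S} (hv : ∀ s, v s ∈ 𝒮 (α s)) :
    B.face n t f v =
      ε (∑ s ∈ Finset.Iio t, α s) (α t) •
        B.actValue (v t) (cochainScale ε 𝒮 ℳ n (α t) f (t.removeNth v))
      - ε (α t) (∑ s ∈ Finset.Ioi t, α s) • B.actLast (v t) (f (t.removeNth v))
      + ε (α t) (∑ s ∈ Finset.Ioi t, α s) • B.actRight (v t) (f (t.removeNth v))
      - ∑ j ∈ Finset.Ioi t, ε (α t) (∑ s ∈ Finset.Ioo t j, α s) •
          f (t.removeNth (Function.update v j (A.bracket (α t) (α j) (v t) (v j)))) := by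
  have hsum (G : Fin (n + 1) → S →ₗ[k] M) :
      ∑ j ∈ Finset.Ioi t, G j = ∑ j : {j // t < j}, G j :=
    Finset.sum_subtype (Finset.Ioi t) (by simp) G
  rw [face, LinearMap.comp_apply, extendHomogeneous_apply _ hv, hsum]
  simp [insertTerm, bracketTerm, Units.smul_def, LinearMap.sum_apply]

theorem evalHead_face_succ {n : ℕ} (t : Fin (n + 1)) (f : TensorCochain k S M (n + 1)) (x : S) :
    evalHead k x (B.face (n + 1) t.succ f) = B.face n t (evalHead k x f) := by
  suffices h : (evalHead k).flip (B.face (n + 1) t.succ f) = B.face n t ∘ₗ (evalHead k).flip f from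
    LinearMap.congr_fun h x
  refine linearMap_ext_of_homogeneous 𝒮 fun a x hx =>
    multilinearMap_ext_of_homogeneous 𝒮 fun α v hv => ?_
  have hremove (w : Fin (n + 1) → S) : t.succ.removeNth (Fin.cons x w : Fin (n + 2) → S) =
      (Fin.cons x (t.removeNth w) : Fin (n + 1) → S) := Fin.cons_comp_succ_succAbove x w t
  rw [LinearMap.flip_apply, LinearMap.comp_apply, LinearMap.flip_apply, evalHead_apply,
    B.face_apply _ _ (cons_mem hx hv), B.face_apply _ _ hv, hremove, ← evalHead_apply,
    evalHead_cochainScale _ _ hx]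
  simp only [sum_Iio_succ, Fin.sum_Ioi_succ, Fin.sum_Ioo_succ, Fin.cons_zero, Fin.cons_succ,
    ← Fin.cons_update, hremove, ← evalHead_apply, smul_apply, ε.val_add_left]
  simp only [Units.smul_def, map_smul, smul_smul, Units.val_mul]
  rw [mul_right_comm, ε.coe_mul_coe_swap, one_mul]

theorem evalHead_evalHead_face_zero {n : ℕ} (f : TensorCochain k S M (n + 1)) {a b : Γ} {x y : S}
    (hx : x ∈ 𝒮 a) (hy : y ∈ 𝒮 b) :
    evalHead k y (evalHead k x (B.face (n + 1) 0 f)) =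
      ε a b • evalHead k x (B.face n 0 (evalHead k y f)) - evalHead k (A.bracket a b x y) f := by
  refine multilinearMap_ext_of_homogeneous 𝒮 fun α v hv => ?_
  have hscale : cochainScale ε 𝒮 ℳ (n + 1) a f (Fin.cons y v) =
      ε a b • cochainScale ε 𝒮 ℳ n a (evalHead k y f) v := by
    rw [← evalHead_apply, evalHead_cochainScale _ _ hy, smul_apply]
  rw [evalHead_apply, evalHead_apply, B.face_apply _ _ (cons_mem hx (cons_mem hy hv)), sub_apply,
    smul_apply, evalHead_apply, B.face_apply _ _ (cons_mem hx hv)]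
  simp only [Fin.sum_Ioi_zero, Fin.sum_univ_succ (n := n), sum_Ioo_zero_succ, sum_Iio_succ,
    sum_Iio_zero, ε.val_zero_left,
    ε.val_zero_right, ε.val_add_right, Fin.cons_zero, Fin.cons_succ,
    ← Fin.cons_update, Fin.removeNth_zero, Fin.tail_cons, hscale, evalHead_apply,
    Fin.update_cons_zero]
  simp only [smul_sub, smul_add, mul_smul, Finset.smul_sum, Units.smul_def, map_smul,
    one_smul]
  abel

theorem face_zero_apply (f : TensorCochain k S M 0) {a c : Γ} {x z : S} (hx : x ∈ 𝒮 a)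
    (hz : z ∈ 𝒮 c) (v : Fin 0 → S) :
    B.face 0 0 f (Fin.cons x v) z =
      ε a c • B.twistedLeft x (f v z) - f v (A.mul x z) + B.right (f v x) z := by
  rw [B.face_apply (α := fun _ => a) 0 f (by simpa using hx)]
  simp [actValue, actLast, actRight, B.twistedLeft_apply hx, ε.val_zero_left, ε.val_zero_right,
    cochainScale_apply, Subsingleton.elim _ v, degreeScale_of_mem _ hz, ε.val_neg_right,
    Units.smul_def]

end GenLeftSymmBimodule

/-! ### The pre-simplicial identities -/

namespace GenLeftSymmBimodule

variable {A : GenLeftSymmAlgebra ε 𝒮} (B : GenLeftSymmBimodule A ℳ)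

theorem D_succ {n : ℕ} (t : Fin (n + 1)) : B.D (t + 1) n = B.face n t :=
  dif_pos (by omega)

theorem D_one (n : ℕ) : B.D 1 n = B.face n 0 := B.D_succ 0

theorem D_of_lt {t n : ℕ} (h : n + 1 < t) : B.D t n = 0 := dif_neg (by omega)

theorem D_zero (n : ℕ) : B.D 0 n = 0 := dif_neg (by omega)

theorem evalHead_D (t n : ℕ) (f : TensorCochain k S M (n + 1)) (x : S) :
    evalHead k x (B.D (t + 2) (n + 1) f) = B.D (t + 1) n (evalHead k x f) := by
  rcases lt_or_ge t (n + 1) with h | h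
  · let t' : Fin (n + 1) := ⟨t, h⟩
    rw [show B.D (t + 2) (n + 1) = B.face (n + 1) t'.succ from B.D_succ t'.succ,
      show B.D (t + 1) n = B.face n t' from B.D_succ t', evalHead_face_succ]
  · simp [B.D_of_lt (show n + 1 < t + 1 by omega), B.D_of_lt (show n + 1 + 1 < t + 2 by omega)]

/-- The action `L_x = ι_x D₁` of `S` on tensor cochains. -/
def lieAct (n : ℕ) : S →ₗ[k] TensorCochain k S M n →ₗ[k] TensorCochain k S M n :=
  (evalHead k).compl₂ (B.D 1 n)

theorem evalHead_D_one (n : ℕ) (f : TensorCochain k S M n) (x : S) :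
    evalHead k x (B.D 1 n f) = B.lieAct n x f := rfl

theorem lieAct_zero_apply (f : TensorCochain k S M 0) {a c : Γ} {x z : S} (hx : x ∈ 𝒮 a)
    (hz : z ∈ 𝒮 c) (v : Fin 0 → S) :
    B.lieAct 0 x f v z =
      ε a c • B.twistedLeft x (f v z) - f v (A.mul x z) + B.right (f v x) z := by
  rw [← evalHead_D_one, evalHead_apply, D_one, B.face_zero_apply f hx hz]

theorem evalHead_lieAct {n : ℕ} (f : TensorCochain k S M (n + 1)) {a b : Γ} {x y : S}
    (hx : x ∈ 𝒮 a) (hy : y ∈ 𝒮 b) :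
    evalHead k y (B.lieAct (n + 1) x f) =
      ε a b • B.lieAct n x (evalHead k y f) - evalHead k (A.bracket a b x y) f := by
  rw [← evalHead_D_one, ← evalHead_D_one, D_one, D_one, B.evalHead_evalHead_face_zero f hx hy]

theorem lieAct_zero_lieAct_zero_apply (f : TensorCochain k S M 0) {a b c : Γ} {x y z : S}
    (hx : x ∈ 𝒮 a) (hy : y ∈ 𝒮 b) (hz : z ∈ 𝒮 c) (v : Fin 0 → S) :
    B.lieAct 0 y (B.lieAct 0 x f) v z =
      (ε a c * ε b c) • B.twistedLeft y (B.twistedLeft x (f v z))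
      - ε b c • B.twistedLeft y (f v (A.mul x z))
      - (ε a b * ε a c) • B.twistedLeft x (f v (A.mul y z))
      + f v (A.mul x (A.mul y z)) - B.right (f v (A.mul x y)) z
      + B.right (B.twistedLeft y (f v x)) z + ε a b • B.right (B.twistedLeft x (f v y)) z := by
  have h := B.right_twistedLeft hy hz (f v x)
  rw [B.lieAct_zero_apply _ hy hz, B.lieAct_zero_apply f hx hz,
    B.lieAct_zero_apply f hx (A.mul_mem hy hz), B.lieAct_zero_apply f hx hy]
  simp only [map_add, map_sub, map_smul, LinearMap.add_apply, LinearMap.sub_apply,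
    LinearMap.smul_apply, ε.val_add_right, Units.smul_def, Units.val_mul] at h ⊢
  linear_combination (norm := module) -h

theorem lieAct_zero_lieAct_zero (f : TensorCochain k S M 0) {a b : Γ} {x y : S}
    (hx : x ∈ 𝒮 a) (hy : y ∈ 𝒮 b) :
    B.lieAct 0 y (B.lieAct 0 x f) =
      ε a b • B.lieAct 0 x (B.lieAct 0 y f) - B.lieAct 0 (A.bracket a b x y) f := by
  ext1 v
  refine linearMap_ext_of_homogeneous 𝒮 fun c z hz => ?_
  have hleft := B.twistedLeft_twistedLeft hx hy (f v z)
  have hmul := congrArg (f v) (A.mul_bracket hx hy z)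
  rw [sub_apply, smul_apply, LinearMap.sub_apply, LinearMap.smul_apply,
    B.lieAct_zero_lieAct_zero_apply f hx hy hz, B.lieAct_zero_lieAct_zero_apply f hy hx hz,
    B.lieAct_zero_apply f (A.bracket_mem hx hy) hz, hleft, hmul]
  simp only [A.bracket_apply, map_sub, map_smul, LinearMap.sub_apply, LinearMap.smul_apply,
    ε.val_add_left, Units.smul_def, Units.val_mul]
  linear_combination (norm := module) ε.coe_mul_coe_swap a b •
    ((ε b c : k) • B.twistedLeft y (f v (A.mul x z)) - B.right (B.twistedLeft y (f v x)) z)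

theorem lieAct_lieAct {n : ℕ} (f : TensorCochain k S M n) {a b : Γ} {x y : S}
    (hx : x ∈ 𝒮 a) (hy : y ∈ 𝒮 b) :
    B.lieAct n y (B.lieAct n x f) =
      ε a b • B.lieAct n x (B.lieAct n y f) - B.lieAct n (A.bracket a b x y) f := by
  induction n with
  | zero => exact B.lieAct_zero_lieAct_zero f hx hy
  | succ n ih =>
    refine ext_evalHead_of_homogeneous 𝒮 fun c z hz => ?_
    have hind := ih (evalHead k z f)
    have hjac := congrArg (fun w => evalHead k w f) (A.jacobi hx hy hz)
    simp only [Units.smul_def, map_add, map_sub, map_smul, LinearMap.add_apply,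
      LinearMap.smul_apply, B.evalHead_lieAct _ hx hz, B.evalHead_lieAct _ hy hz,
      B.evalHead_lieAct _ (A.bracket_mem hx hy) hz, B.evalHead_lieAct _ hx (A.bracket_mem hy hz),
      B.evalHead_lieAct _ hy (A.bracket_mem hx hz), ε.val_add_left, ε.val_add_right,
      Units.val_mul] at hind hjac ⊢
    linear_combination (norm := module) ((ε a c : k) * ε b c) • hind + hjac +
      ε.coe_mul_coe_swap a b •
        ((ε b c : k) • B.lieAct n y (evalHead k (A.bracket a c x z) f))

theorem lieAct_D (t n : ℕ) (f : TensorCochain k S M n) (x : S) :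
    B.lieAct (n + 1) x (B.D (t + 1) n f) = B.D (t + 1) n (B.lieAct n x f) := by
  suffices h : (B.lieAct (n + 1)).flip (B.D (t + 1) n f) =
      B.D (t + 1) n ∘ₗ (B.lieAct n).flip f from LinearMap.congr_fun h x
  refine linearMap_ext_of_homogeneous 𝒮 fun a x hx => ?_
  simp only [LinearMap.flip_apply, LinearMap.comp_apply]
  induction t generalizing n with
  | zero =>
    refine ext_evalHead_of_homogeneous 𝒮 fun b y hy => ?_
    rw [B.evalHead_lieAct _ hx hy, zero_add, evalHead_D_one, evalHead_D_one, evalHead_D_one,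
      B.lieAct_lieAct f hx hy]
  | succ t ih =>
    cases n with
    | zero => simp [D_of_lt]
    | succ n =>
      refine ext_evalHead_of_homogeneous 𝒮 fun b y hy => ?_
      rw [B.evalHead_lieAct _ hx hy, evalHead_D, evalHead_D, evalHead_D, ih,
        B.evalHead_lieAct _ hx hy]
      simp only [Units.smul_def, map_sub, map_smul]

theorem D_D (s t n : ℕ) (f : TensorCochain k S M n) :
    B.D (s + t + 2) (n + 1) (B.D (s + 1) n f) = B.D (s + 1) (n + 1) (B.D (s + t + 1) n f) := by
  induction s generalizing n with
  | zero =>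
    refine ext_evalHead fun x => ?_
    rw [zero_add, evalHead_D, evalHead_D_one, evalHead_D_one, lieAct_D]
  | succ s ih =>
    rw [add_right_comm s 1 t]
    cases n with
    | zero => simp [D_of_lt]
    | succ n =>
      refine ext_evalHead fun x => ?_
      rw [evalHead_D, evalHead_D, evalHead_D, evalHead_D, ih]

theorem D_comp_D {s t : ℕ} (hs : 1 ≤ s) (hst : s < t) (n : ℕ) :
    B.D t (n + 1) ∘ₗ B.D s n = B.D s (n + 1) ∘ₗ B.D (t - 1) n := by
  obtain ⟨s, rfl⟩ := Nat.exists_eq_add_of_le' hs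
  obtain ⟨t, rfl⟩ := Nat.exists_eq_add_of_lt hst
  rw [show s + 1 + t + 1 = s + t + 2 by ring]
  exact LinearMap.ext (B.D_D s t n)

theorem tensorDiff_apply (n : ℕ) (f : TensorCochain k S M n) :
    B.tensorDiff n f = ∑ t ∈ Finset.range (n + 1), (-1 : k) ^ t • B.D (t + 1) n f := by
  have hIcc : Finset.Icc 1 (n + 1) = Finset.Ico (0 + 1) (n + 1 + 1) := by ext; simp
  rw [tensorDiff, hIcc, ← Finset.sum_Ico_add', ← Finset.range_eq_Ico]
  simp [pow_succ]

theorem evalHead_tensorDiff_zero (f : TensorCochain k S M 0) (x : S) :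
    evalHead k x (B.tensorDiff 0 f) = B.lieAct 0 x f := by
  simp [tensorDiff_apply, evalHead_D_one]

/-- Cartan's formula `ι_x d + d ι_x = L_x`. -/
theorem evalHead_tensorDiff_succ (n : ℕ) (f : TensorCochain k S M (n + 1)) (x : S) :
    evalHead k x (B.tensorDiff (n + 1) f) =
      B.lieAct (n + 1) x f - B.tensorDiff n (evalHead k x f) := by
  rw [tensorDiff_apply, tensorDiff_apply, Finset.sum_range_succ', map_add, map_sum, sub_eq_neg_add,
    ← Finset.sum_neg_distrib]
  simp only [map_smul, evalHead_D, zero_add, evalHead_D_one, pow_zero, one_smul]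
  congr! 2 with t
  rw [pow_succ]
  module

theorem lieAct_tensorDiff (n : ℕ) (f : TensorCochain k S M n) (x : S) :
    B.lieAct (n + 1) x (B.tensorDiff n f) = B.tensorDiff n (B.lieAct n x f) := by
  simp only [tensorDiff_apply, map_sum, map_smul, lieAct_D]

theorem tensorDiff_tensorDiff (n : ℕ) (f : TensorCochain k S M n) :
    B.tensorDiff (n + 1) (B.tensorDiff n f) = 0 := by
  induction n with
  | zero =>
    refine ext_evalHead fun x => ?_
    rw [evalHead_tensorDiff_succ, evalHead_tensorDiff_zero, lieAct_tensorDiff, sub_self, map_zero]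
  | succ n ih =>
    refine ext_evalHead fun x => ?_
    rw [evalHead_tensorDiff_succ, evalHead_tensorDiff_succ, lieAct_tensorDiff, map_sub, ih,
      sub_zero, sub_self, map_zero]

end GenLeftSymmBimodule

theorem cochainScale_of_mem {n : ℕ} (a : Γ) {β : Γ} {f : TensorCochain k S M n}
    (hf : f ∈ homogeneousTensorCochain 𝒮 ℳ n β) :
    cochainScale ε 𝒮 ℳ n a f = ε β a • f := by
  induction n generalizing β with
  | zero =>
    ext1 v
    refine linearMap_ext_of_homogeneous 𝒮 fun c y hy => ?_
    have hfvy : f v y ∈ ℳ (β + c) := mem_homogeneousTensorCochain_zero.1 hf c v y hy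
    rw [cochainScale_apply, degreeScale_of_mem _ hy, ε.val_neg_right, Units.smul_def, map_smul,
      map_smul, Subsingleton.elim (fun s => degreeScale ε 𝒮 (-a) (v s)) v,
      degreeScale_of_mem _ hfvy, ← Units.smul_def, smul_smul, ε.val_add_left, mul_left_comm,
      ε.val_mul_val_swap, mul_one, smul_apply, LinearMap.smul_apply]
  | succ n ih =>
    refine ext_evalHead_of_homogeneous 𝒮 fun b x hx => ?_
    rw [evalHead_cochainScale _ _ hx, ih (mem_homogeneousTensorCochain_succ.1 hf b x hx), smul_smul,
      ε.val_add_left, mul_left_comm, ε.val_mul_val_swap, mul_one, Units.smul_def, Units.smul_def,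
      map_smul]

namespace GenLeftSymmBimodule

variable {A : GenLeftSymmAlgebra ε 𝒮} (B : GenLeftSymmBimodule A ℳ)

theorem D_apply {n : ℕ} (t : Fin (n + 1)) {β : Γ} {f : TensorCochain k S M n}
    {α : Fin (n + 1) → Γ} {v : Fin (n + 1) → S} (y : S)
    (hf : f ∈ homogeneousTensorCochain 𝒮 ℳ n β) (hv : ∀ s, v s ∈ 𝒮 (α s)) :
    B.D (t + 1) n f v y =
      ε (β + ∑ s ∈ Finset.Iio t, α s) (α t) • B.left (v t) (f (t.removeNth v) y)
      - ε (α t) (∑ s ∈ Finset.Ioi t, α s) • f (t.removeNth v) (A.mul (v t) y)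
      + ε (α t) (∑ s ∈ Finset.Ioi t, α s) • B.right (f (t.removeNth v) (v t)) y
      - ∑ j ∈ Finset.Ioi t, ε (α t) (∑ s ∈ Finset.Ioo t j, α s) •
          f (t.removeNth (Function.update v j
            (A.mul (v t) (v j) - ε (α t) (α j) • A.mul (v j) (v t)))) y := by
  rw [D_succ, B.face_apply _ _ hv, cochainScale_of_mem _ hf]
  simp [actValue, actLast, actRight, A.bracket_apply, Units.smul_def, smul_smul, mul_comm,
    ε.val_add_left]

theorem lieAct_mem {n : ℕ} {a β : Γ} {x : S} (hx : x ∈ 𝒮 a) {f : TensorCochain k S M n}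
    (hf : f ∈ homogeneousTensorCochain 𝒮 ℳ n β) :
    B.lieAct n x f ∈ homogeneousTensorCochain 𝒮 ℳ n (β + a) := by
  induction n generalizing β with
  | zero =>
    rw [mem_homogeneousTensorCochain_zero] at hf ⊢
    intro δ v y hy
    have hleft := B.twistedLeft_mem hx (hf δ v y hy)
    have hmul := hf (a + δ) v _ (A.mul_mem hx hy)
    have hright := B.right_mem (hf a v x hx) hy
    rw [add_right_comm] at hleft
    rw [← add_assoc] at hmul
    rw [B.lieAct_zero_apply f hx hy]
    exact add_mem (sub_mem ((ℳ _).smul_mem (ε a δ : k) hleft) hmul) hright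
  | succ n ih =>
    rw [mem_homogeneousTensorCochain_succ] at hf ⊢
    intro b y hy
    rw [B.evalHead_lieAct _ hx hy]
    refine sub_mem (Submodule.smul_mem _ (ε a b : k) ?_) ?_
    · exact add_right_comm β a b ▸ ih (hf b y hy)
    · exact add_assoc β a b ▸ hf _ _ (A.bracket_mem hx hy)

theorem D_mem (t n : ℕ) {β : Γ} {f : TensorCochain k S M n}
    (hf : f ∈ homogeneousTensorCochain 𝒮 ℳ n β) :
    B.D t n f ∈ homogeneousTensorCochain 𝒮 ℳ (n + 1) β := by
  match t, n with
  | 0, n => simp [D_zero]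
  | 1, n => exact mem_homogeneousTensorCochain_succ.2 fun a x hx => B.lieAct_mem hx hf
  | t + 2, 0 => simp [D_of_lt]
  | t + 2, n + 1 =>
    refine mem_homogeneousTensorCochain_succ.2 fun a x hx => ?_
    rw [evalHead_D]
    exact D_mem _ _ (mem_homogeneousTensorCochain_succ.1 hf a x hx)

theorem tensorDiff_mem (n : ℕ) {β : Γ} {f : TensorCochain k S M n}
    (hf : f ∈ homogeneousTensorCochain 𝒮 ℳ n β) :
    B.tensorDiff n f ∈ homogeneousTensorCochain 𝒮 ℳ (n + 1) β := by
  rw [tensorDiff_apply]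
  exact Submodule.sum_mem _ fun t _ => Submodule.smul_mem _ _ (B.D_mem _ _ hf)

end GenLeftSymmBimodule

/-! ### Invariance of the `ε`-alternating cochains -/

namespace GenLeftSymmBimodule

variable {A : GenLeftSymmAlgebra ε 𝒮} (B : GenLeftSymmBimodule A ℳ)

theorem evalHead_evalHead_lieAct_add_swap {n : ℕ} {f : TensorCochain k S M (n + 2)}
    (hf : f ∈ altTensorCochain M ε 𝒮 (n + 2)) {a b c : Γ} {x y z : S} (hx : x ∈ 𝒮 a)
    (hy : y ∈ 𝒮 b) (hz : z ∈ 𝒮 c) :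
    evalHead k z (evalHead k y (B.lieAct (n + 2) x f)) +
      ε b c • evalHead k y (evalHead k z (B.lieAct (n + 2) x f)) = 0 := by
  have hyz := congrArg (B.lieAct n x) (evalHead_evalHead_add_swap hf hy hz)
  have hxyz := evalHead_evalHead_add_swap hf (A.bracket_mem hx hy) hz
  have hyxz := evalHead_evalHead_add_swap hf hy (A.bracket_mem hx hz)
  simp only [B.evalHead_lieAct _ hx hy, B.evalHead_lieAct _ hx hz, map_sub, Units.smul_def,
    map_smul, map_add, map_zero, ε.val_add_left, ε.val_add_right, Units.val_mul] at hyz hxyz hyxz ⊢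
  linear_combination (norm := module) ((ε a b : k) * ε a c) • hyz - hxyz - (ε a b : k) • hyxz +
    ε.coe_mul_coe_swap b a • ((ε b c : k) • evalHead k y (evalHead k (A.bracket a c x z) f))

theorem lieAct_mem_altTensorCochain {n : ℕ} {a : Γ} {x : S} (hx : x ∈ 𝒮 a)
    {f : TensorCochain k S M n} (hf : f ∈ altTensorCochain M ε 𝒮 n) :
    B.lieAct n x f ∈ altTensorCochain M ε 𝒮 n := by
  match n with
  | 0 | 1 => exact mem_altTensorCochain_of_le_one (by simp) _
  | n + 2 =>
    refine mem_altTensorCochain_add_two (fun b y hy => ?_) fun b c y z hy hz =>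
      B.evalHead_evalHead_lieAct_add_swap hf hx hy hz
    rw [B.evalHead_lieAct _ hx hy]
    exact sub_mem (Submodule.smul_mem _ (ε a b : k)
      (lieAct_mem_altTensorCochain hx (evalHead_mem_altTensorCochain hf y)))
      (evalHead_mem_altTensorCochain hf _)

theorem evalHead_tensorDiff_evalHead_add_swap {n : ℕ} {f : TensorCochain k S M (n + 1)}
    (hf : f ∈ altTensorCochain M ε 𝒮 (n + 1)) {a b : Γ} {x y : S} (hx : x ∈ 𝒮 a) (hy : y ∈ 𝒮 b) :
    evalHead k y (B.tensorDiff n (evalHead k x f)) +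
        ε a b • evalHead k x (B.tensorDiff n (evalHead k y f)) =
      B.lieAct n y (evalHead k x f) + ε a b • B.lieAct n x (evalHead k y f) := by
  cases n with
  | zero => rw [evalHead_tensorDiff_zero, evalHead_tensorDiff_zero]
  | succ n =>
    have hdiff := congrArg (B.tensorDiff n) (evalHead_evalHead_add_swap hf hx hy)
    rw [evalHead_tensorDiff_succ, evalHead_tensorDiff_succ]
    simp only [Units.smul_def, map_add, map_smul, map_zero] at hdiff ⊢
    linear_combination (norm := module) -hdiff

theorem evalHead_evalHead_tensorDiff_add_swap {n : ℕ} {f : TensorCochain k S M (n + 1)}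
    (hf : f ∈ altTensorCochain M ε 𝒮 (n + 1)) {a b : Γ} {x y : S} (hx : x ∈ 𝒮 a) (hy : y ∈ 𝒮 b) :
    evalHead k y (evalHead k x (B.tensorDiff (n + 1) f)) +
      ε a b • evalHead k x (evalHead k y (B.tensorDiff (n + 1) f)) = 0 := by
  have hdiff := B.evalHead_tensorDiff_evalHead_add_swap hf hx hy
  have hbracket := congrArg (fun w => evalHead k w f) (A.smul_bracket_swap a b x y)
  simp only [evalHead_tensorDiff_succ, map_sub, map_smul, map_neg, LinearMap.smul_apply,
    LinearMap.neg_apply, B.evalHead_lieAct _ hx hy, B.evalHead_lieAct _ hy hx,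
    Units.smul_def] at hdiff hbracket ⊢
  linear_combination (norm := module) -hdiff - hbracket +
    ε.coe_mul_coe_swap a b • B.lieAct n y (evalHead k x f)

theorem tensorDiff_mem_altTensorCochain {n : ℕ} {f : TensorCochain k S M n}
    (hf : f ∈ altTensorCochain M ε 𝒮 n) : B.tensorDiff n f ∈ altTensorCochain M ε 𝒮 (n + 1) := by
  induction n with
  | zero => exact mem_altTensorCochain_of_le_one (by simp) _
  | succ n ih =>
    refine mem_altTensorCochain_add_two (fun a x hx => ?_) fun a b x y hx hy =>
      B.evalHead_evalHead_tensorDiff_add_swap hf hx hy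
    rw [evalHead_tensorDiff_succ]
    exact sub_mem (B.lieAct_mem_altTensorCochain hx hf) (ih (evalHead_mem_altTensorCochain hf x))

end GenLeftSymmBimodule

/-! ### The coboundary operators -/

namespace GenLeftSymmBimodule

variable {A : GenLeftSymmAlgebra ε 𝒮} (B : GenLeftSymmBimodule A ℳ)

theorem isHomogeneous_cochainZero : DirectSum.SetLike.IsHomogeneous ℳ B.cochainZero := by
  intro γ m hm
  suffices h : A.mul.compr₂ (B.left.flip (DirectSum.decompose ℳ m γ)) =
      B.left.compl₂ (B.left.flip (DirectSum.decompose ℳ m γ)) from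
    fun x y => LinearMap.congr_fun₂ h x y
  refine linearMap_ext_of_homogeneous 𝒮 fun a x hx =>
    linearMap_ext_of_homogeneous 𝒮 fun b y hy => ?_
  have hshift (μ : Γ) (m : M) (hm : m ∈ ℳ μ) :
      (B.left (A.mul x y) - B.left x ∘ₗ B.left y) m ∈ ℳ (a + b + μ) :=
    sub_mem (B.left_mem (A.mul_mem hx hy) hm)
      (add_assoc a b μ ▸ B.left_mem hx (B.left_mem hy hm))
  have h := coe_decompose_apply_of_homogeneous ℳ ℳ hshift γ m
  rw [LinearMap.sub_apply, LinearMap.comp_apply, hm x y, sub_self, DirectSum.decompose_zero] at h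
  exact sub_eq_zero.1 h.symm

theorem twistedLeft_mul {m : M} (hm : m ∈ B.cochainZero) {γ : Γ} (hmγ : m ∈ ℳ γ) {a b : Γ}
    {x y : S} (hx : x ∈ 𝒮 a) (hy : y ∈ 𝒮 b) :
    B.twistedLeft (A.mul x y) m = ε a b • B.twistedLeft x (B.twistedLeft y m) := by
  rw [B.twistedLeft_of_mem (A.mul_mem hx hy) hmγ,
    B.twistedLeft_of_mem hx (B.twistedLeft_mem hy hmγ), B.twistedLeft_of_mem hy hmγ, hm x y]
  simp only [Units.smul_def, map_smul, ε.val_add_left, ε.val_add_right, Units.val_mul]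
  linear_combination (norm := module)
    -ε.coe_mul_coe_swap a b • ((ε γ a * ε γ b : k) • B.left x (B.left y m))

/-- The inner derivation `innerDerivation m x = ε(β, α) x·m - m·x` for `m ∈ M_β` and `x ∈ S_α`. -/
def innerDerivation : M →ₗ[k] S →ₗ[k] M := B.twistedLeft.flip - B.right

theorem innerDerivation_apply (m : M) (x : S) :
    B.innerDerivation m x = B.twistedLeft x m - B.right m x := rfl

/-- The coboundary operator `d : C^0(S, M) → C^1(S, M)`, which sends `m` to its inner derivation. -/
def coboundaryZero : B.cochainZero →ₗ[k] Cochain M ε 𝒮 0 :=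
  (cochainEquiv M ε 𝒮 0).symm.toLinearMap ∘ₗ
    ((MultilinearMap.constLinearEquivOfIsEmpty (R := k) (S := k) (M₁ := fun _ : Fin 0 => S)
      (M₂ := S →ₗ[k] M)).toLinearMap ∘ₗ B.innerDerivation ∘ₗ B.cochainZero.subtype).codRestrict _
        fun _ => mem_altTensorCochain_of_le_one zero_le_one _

theorem toTensor_coboundaryZero_apply (m : B.cochainZero) (v : Fin 0 → S) :
    (B.coboundaryZero m).toTensor v = B.innerDerivation m := by
  rw [coboundaryZero, LinearMap.comp_apply, LinearEquiv.coe_coe, toTensor_cochainEquiv_symm]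
  rfl

/-- The coboundary operator `d : C^{n+1}(S, M) → C^{n+2}(S, M)`, the restriction of `tensorDiff`. -/
def coboundary (n : ℕ) : Cochain M ε 𝒮 n →ₗ[k] Cochain M ε 𝒮 (n + 1) :=
  (cochainEquiv M ε 𝒮 (n + 1)).symm.toLinearMap ∘ₗ
    (B.tensorDiff n ∘ₗ Cochain.toTensor).codRestrict _ fun f =>
      B.tensorDiff_mem_altTensorCochain f.toTensor_mem

theorem toTensor_coboundary (n : ℕ) (f : Cochain M ε 𝒮 n) :
    (B.coboundary n f).toTensor = B.tensorDiff n f.toTensor := by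
  rw [coboundary, LinearMap.comp_apply, LinearEquiv.coe_coe, toTensor_cochainEquiv_symm]
  rfl

theorem isCoboundaryZero_iff {d₀ : B.cochainZero →ₗ[k] Cochain M ε 𝒮 0} :
    B.IsCoboundaryZero d₀ ↔ d₀ = B.coboundaryZero := by
  constructor
  · intro h
    refine linearMap_ext_of_isHomogeneous ℳ B.isHomogeneous_cochainZero fun β m hm =>
      Cochain.toTensor_injective ?_
    ext1 v
    refine linearMap_ext_of_homogeneous 𝒮 fun a x hx => ?_
    rw [Subsingleton.elim v Fin.elim0, h a β m x hm hx, toTensor_coboundaryZero_apply,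
      innerDerivation_apply, B.twistedLeft_of_mem hx hm]
  · rintro rfl α β m x hm hx
    rw [toTensor_coboundaryZero_apply, innerDerivation_apply, B.twistedLeft_of_mem hx hm]

theorem isCoboundarySucc_iff {d : ∀ n, Cochain M ε 𝒮 n →ₗ[k] Cochain M ε 𝒮 (n + 1)} :
    B.IsCoboundarySucc d ↔ d = B.coboundary :=
  ⟨fun h => funext fun n => LinearMap.ext fun f =>
      Cochain.toTensor_injective ((h n f).trans (B.toTensor_coboundary n f).symm),
    fun h => h ▸ B.toTensor_coboundary⟩

theorem coboundaryZero_mem {β : Γ} {m : B.cochainZero} (hm : (m : M) ∈ ℳ β) :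
    B.coboundaryZero m ∈ homogeneousCochain ε 𝒮 ℳ 0 β := by
  refine mem_homogeneousTensorCochain_zero.2 fun δ v y hy => ?_
  rw [toTensor_coboundaryZero_apply]
  exact sub_mem (B.twistedLeft_mem hy hm) (B.right_mem hm hy)

theorem coboundary_mem (n : ℕ) {β : Γ} {f : Cochain M ε 𝒮 n}
    (hf : f ∈ homogeneousCochain ε 𝒮 ℳ n β) :
    B.coboundary n f ∈ homogeneousCochain ε 𝒮 ℳ (n + 1) β := by
  rw [homogeneousCochain, Submodule.mem_comap, toTensor_coboundary]
  exact B.tensorDiff_mem n hf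

theorem coboundary_comp_coboundaryZero : B.coboundary 0 ∘ₗ B.coboundaryZero = 0 := by
  refine linearMap_ext_of_isHomogeneous ℳ B.isHomogeneous_cochainZero fun γ m hm =>
    Cochain.toTensor_injective ?_
  rw [LinearMap.comp_apply, toTensor_coboundary, LinearMap.zero_apply, map_zero]
  refine ext_evalHead_of_homogeneous 𝒮 fun a x hx => ?_
  ext1 v
  refine linearMap_ext_of_homogeneous 𝒮 fun b y hy => ?_
  have hmul := B.twistedLeft_mul m.2 hm hx hy
  have hright := B.right_twistedLeft hx hy (m : M)
  rw [evalHead_tensorDiff_zero, B.lieAct_zero_apply _ hx hy, toTensor_coboundaryZero_apply]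
  simp only [innerDerivation_apply, map_sub, map_zero, zero_apply, LinearMap.sub_apply,
    LinearMap.zero_apply, Units.smul_def] at hmul hright ⊢
  linear_combination (norm := module) hright - hmul

theorem coboundary_comp_coboundary (n : ℕ) : B.coboundary (n + 1) ∘ₗ B.coboundary n = 0 := by
  refine LinearMap.ext fun f => Cochain.toTensor_injective ?_
  rw [LinearMap.comp_apply, toTensor_coboundary, toTensor_coboundary, tensorDiff_tensorDiff,
    LinearMap.zero_apply, map_zero]

end GenLeftSymmBimodule

end

end

theorem proposition3p1_general {Γ : Type uΓ} {k : Type uk} {S : Type uS} {M : Type uM}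
    [AddCommGroup Γ] [DecidableEq Γ] [Field k]
    [AddCommGroup S] [Module k S]
    [AddCommGroup M] [Module k M]
    (ε : CommutationFactor Γ k)
    (𝒮 : Γ → Submodule k S) [DirectSum.Decomposition 𝒮]
    (ℳ : Γ → Submodule k M) [DirectSum.Decomposition ℳ]
    (A : GenLeftSymmAlgebra ε 𝒮) (B : GenLeftSymmBimodule A ℳ) :
    (∀ (n : ℕ) (t : Fin (n + 1)) (β : Γ) (f : TensorCochain k S M n)
      (α : Fin (n + 1) → Γ) (v : Fin (n + 1) → S) (y : S),
      f ∈ homogeneousTensorCochain 𝒮 ℳ n β → (∀ s, v s ∈ 𝒮 (α s)) →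
      B.D (t + 1) n f v y =
        ε (β + ∑ s ∈ Finset.Iio t, α s) (α t) • B.left (v t) (f (t.removeNth v) y)
        - ε (α t) (∑ s ∈ Finset.Ioi t, α s) • f (t.removeNth v) (A.mul (v t) y)
        + ε (α t) (∑ s ∈ Finset.Ioi t, α s) • B.right (f (t.removeNth v) (v t)) y
        - ∑ j ∈ Finset.Ioi t, ε (α t) (∑ s ∈ Finset.Ioo t j, α s) •
            f (t.removeNth (Function.update v j
              (A.mul (v t) (v j) - ε (α t) (α j) • A.mul (v j) (v t)))) y) ∧
    (∀ t n : ℕ, n + 1 < t → B.D t n = 0) ∧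
    (∀ (t n : ℕ) (β : Γ) (f : TensorCochain k S M n),
      f ∈ homogeneousTensorCochain 𝒮 ℳ n β →
      B.D t n f ∈ homogeneousTensorCochain 𝒮 ℳ (n + 1) β) ∧
    (∀ s t n : ℕ, 1 ≤ s → s < t →
      B.D t (n + 1) ∘ₗ B.D s n = B.D s (n + 1) ∘ₗ B.D (t - 1) n) ∧
    (∀ n : ℕ, B.tensorDiff (n + 1) ∘ₗ B.tensorDiff n = 0) ∧
    (∃! d₀ : B.cochainZero →ₗ[k] Cochain M ε 𝒮 0, B.IsCoboundaryZero d₀) ∧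
    (∃! d : ∀ n, Cochain M ε 𝒮 n →ₗ[k] Cochain M ε 𝒮 (n + 1), B.IsCoboundarySucc d) ∧
    (∀ (d₀ : B.cochainZero →ₗ[k] Cochain M ε 𝒮 0)
      (d : ∀ n, Cochain M ε 𝒮 n →ₗ[k] Cochain M ε 𝒮 (n + 1)),
      B.IsCoboundaryZero d₀ → B.IsCoboundarySucc d →
      (∀ (β : Γ) (m : B.cochainZero), (m : M) ∈ ℳ β → d₀ m ∈ homogeneousCochain ε 𝒮 ℳ 0 β) ∧
      (∀ (n : ℕ) (β : Γ) (f : Cochain M ε 𝒮 n), f ∈ homogeneousCochain ε 𝒮 ℳ n β →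
        d n f ∈ homogeneousCochain ε 𝒮 ℳ (n + 1) β) ∧
      d 0 ∘ₗ d₀ = 0 ∧
      (∀ n : ℕ, d (n + 1) ∘ₗ d n = 0) ∧
      LinearMap.range d₀ ≤ LinearMap.ker (d 0) ∧
      (∀ n : ℕ, LinearMap.range (d n) ≤ LinearMap.ker (d (n + 1)))) := by
  refine ⟨fun n t β f α v y => B.D_apply t y, fun t n => B.D_of_lt, fun t n β f => B.D_mem t n,
    fun s t n hs hst => B.D_comp_D hs hst n, fun n => LinearMap.ext (B.tensorDiff_tensorDiff n),
    ⟨B.coboundaryZero, B.isCoboundaryZero_iff.2 rfl, fun _ => B.isCoboundaryZero_iff.1⟩,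
    ⟨B.coboundary, B.isCoboundarySucc_iff.2 rfl, fun _ => B.isCoboundarySucc_iff.1⟩,
    fun d₀ d h₀ h => ?_⟩
  obtain rfl := B.isCoboundaryZero_iff.1 h₀
  obtain rfl := B.isCoboundarySucc_iff.1 h
  exact ⟨fun β m => B.coboundaryZero_mem, fun n β f => B.coboundary_mem n,
    B.coboundary_comp_coboundaryZero, B.coboundary_comp_coboundary,
    LinearMap.range_le_ker_iff.2 B.coboundary_comp_coboundaryZero,
    fun n => LinearMap.range_le_ker_iff.2 (B.coboundary_comp_coboundary n)⟩

theorem proposition3p1 {Γ : Type uΓ} {k : Type uk} {S : Type uS} {M : Type uM}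
    [AddCommGroup Γ] [DecidableEq Γ] [Field k] [CharZero k]
    [AddCommGroup S] [Module k S] [FiniteDimensional k S]
    [AddCommGroup M] [Module k M] [FiniteDimensional k M]
    (ε : CommutationFactor Γ k)
    (𝒮 : Γ → Submodule k S) [DirectSum.Decomposition 𝒮]
    (ℳ : Γ → Submodule k M) [DirectSum.Decomposition ℳ]
    (A : GenLeftSymmAlgebra ε 𝒮) (B : GenLeftSymmBimodule A ℳ) :
    -- the formula for `D_t` on homogeneous cochains and arguments, for `t ≤ i = n + 1`
    (∀ (n : ℕ) (t : Fin (n + 1)) (β : Γ) (f : TensorCochain k S M n)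
      (α : Fin (n + 1) → Γ) (v : Fin (n + 1) → S) (y : S),
      f ∈ homogeneousTensorCochain 𝒮 ℳ n β → (∀ s, v s ∈ 𝒮 (α s)) →
      B.D (t + 1) n f v y =
        ε (β + ∑ s ∈ Finset.Iio t, α s) (α t) • B.left (v t) (f (t.removeNth v) y)
        - ε (α t) (∑ s ∈ Finset.Ioi t, α s) • f (t.removeNth v) (A.mul (v t) y)
        + ε (α t) (∑ s ∈ Finset.Ioi t, α s) • B.right (f (t.removeNth v) (v t)) y
        - ∑ j ∈ Finset.Ioi t, ε (α t) (∑ s ∈ Finset.Ioo t j, α s) •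
            f (t.removeNth (Function.update v j
              (A.mul (v t) (v j) - ε (α t) (α j) • A.mul (v j) (v t)))) y) ∧
    -- `D_t = 0` on `C^i` for `t > i`
    (∀ t n : ℕ, n + 1 < t → B.D t n = 0) ∧
    -- `D_t` is homogeneous of degree zero
    (∀ (t n : ℕ) (β : Γ) (f : TensorCochain k S M n),
      f ∈ homogeneousTensorCochain 𝒮 ℳ n β →
      B.D t n f ∈ homogeneousTensorCochain 𝒮 ℳ (n + 1) β) ∧
    -- the pre-simplicial identities
    (∀ s t n : ℕ, 1 ≤ s → s < t →
      B.D t (n + 1) ∘ₗ B.D s n = B.D s (n + 1) ∘ₗ B.D (t - 1) n) ∧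
    -- `d² = 0` for `d = -∑ (-1)^t D_t`
    (∀ n : ℕ, B.tensorDiff (n + 1) ∘ₗ B.tensorDiff n = 0) ∧
    -- the coboundary operators of the complex `C^0 → C^1 → C^2 → ⋯` exist and are unique
    (∃! d₀ : B.cochainZero →ₗ[k] Cochain M ε 𝒮 0, B.IsCoboundaryZero d₀) ∧
    (∃! d : ∀ n, Cochain M ε 𝒮 n →ₗ[k] Cochain M ε 𝒮 (n + 1), B.IsCoboundarySucc d) ∧
    -- they are homogeneous of degree zero and square to zero, so that coboundaries are cocycles
    (∀ (d₀ : B.cochainZero →ₗ[k] Cochain M ε 𝒮 0)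
      (d : ∀ n, Cochain M ε 𝒮 n →ₗ[k] Cochain M ε 𝒮 (n + 1)),
      B.IsCoboundaryZero d₀ → B.IsCoboundarySucc d →
      (∀ (β : Γ) (m : B.cochainZero), (m : M) ∈ ℳ β → d₀ m ∈ homogeneousCochain ε 𝒮 ℳ 0 β) ∧
      (∀ (n : ℕ) (β : Γ) (f : Cochain M ε 𝒮 n), f ∈ homogeneousCochain ε 𝒮 ℳ n β →
        d n f ∈ homogeneousCochain ε 𝒮 ℳ (n + 1) β) ∧
      d 0 ∘ₗ d₀ = 0 ∧
      (∀ n : ℕ, d (n + 1) ∘ₗ d n = 0) ∧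
      LinearMap.range d₀ ≤ LinearMap.ker (d 0) ∧
      (∀ n : ℕ, LinearMap.range (d n) ≤ LinearMap.ker (d (n + 1)))) :=
  proposition3p1_general ε 𝒮 ℳ A B
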